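/- Let $(\theta_i,y_i,x_i,D_i)_{i\ge1}$ be random variables with $\theta_i,y_i,D_i\in\mathbb R$ and $x_i\in\mathbb R^p$, and let $\psi_*=(\beta_*,A_*)$. Suppose that the Fay–Herriot model is correctly specified: for every $i$, conditionally on $(x_i,D_i)$, $\theta_i\sim N(x_i^\top\beta_*,A_*)$, and conditionally on $(\theta_i,x_i,D_i)$, $y_i\sim N(\theta_i,D_i)$. Suppose further that 1. the triples $(y_i,x_i,D_i)$, $i\ge 1$, are independent and identically distributed, and there are constants $0<D_L\le D_U<\infty$ with $D_L\le D_i\le D_U$ almost surely; 2. the $x_i$ take values almost surely in a bounded subset of $\mathbb R^p$, and $E[x_ix_i^\top]$ is positive definite; 3. $\Psi\subset\mathbb R^p\times(0,\infty)$ is compact, $\psi_*\in\Psi$, and $A_*+D_L>(2\pi)^{-1}e^{-3}$. Let $\phi(\cdot;\mu,v)$ be the $N(\mu,v)$ density. For $\psi=(\beta,A)\in\Psi$, $\mu_i=x_i^\top\beta$ and $v_i=A+D_i$, put $$\mathcal D_\gamma(y_i;\psi)=\frac1\gamma\,\phi(y_i;\mu_i,v_i)^\gamma\,c_\gamma(\mu_i,v_i)\quad(0<\gamma\le1),\qquad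 \mathcal D_0(y_i;\psi)=\log\phi(y_i;\mu_i,v_i),$$ where $c_\gamma$ is either of the two normalisations $c_\gamma(\mu,v)=\{\int\phi(t;\mu,v)^{1+\gamma}dt\}^{-\gamma/(1+\gamma)}$ or $c_\gamma(\mu,v)=(2\pi v)^{\gamma^2/\{2(1+\gamma)\}}$ (which differ by a factor depending on $\gamma$ only), the same one throughout. Define the robust posterior mean and variance $$\widetilde\theta_i^{(\gamma)}(\psi)=y_i+D_i\frac{d}{dy_i}\mathcal D_\gamma(y_i;\psi),\qquad \widetilde s_i^{2(\gamma)}(\psi)=D_i+D_i^2\frac{d^2}{dy_i^2}\mathcal D_\gamma(y_i;\psi).$$ Let $\Gamma=\{\gamma_1,\dots,\gamma_M\}$ with $0=\gamma_1<\dots<\gamma_M=1$ be a fixed grid. For each number of areas $m$ and each $\gamma\in\Gamma$ let $\widehat\psi^{(\gamma)}=\widehat\psi^{(\gamma)}_m$ be, almost surely, a maximiser of $\sum_{i=1}^m\mathcal D_\gamma(y_i;\psi)$ over $\psi\in\Psi$, and let $\gamma_{op}=\gamma_{op,m}$ be, almost surely, a minimiser over $\gamma\in\Gamma$ of the total estimated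 robust posterior variance $\sum_{i=1}^m\widetilde s_i^{2(\gamma)}(\widehat\psi^{(\gamma)})$. Then $$P(\gamma_{op}=0)\to1\qquad\text{as } m\to\infty.$$ Consequently the method reduces asymptotically to the standard empirical Bayes method: writing $\widehat\psi^{(0)}=(\widehat\beta,\widehat A)$ for the maximum likelihood estimator over $\Psi$, the probability that $$\widetilde\theta_i^{(\gamma_{op})}(\widehat\psi^{(\gamma_{op})})=y_i-\frac{D_i}{\widehat A+D_i}(y_i-x_i^\top\widehat\beta)\quad\text{and}\quad \widetilde s_i^{2(\gamma_{op})}(\widehat\psi^{(\gamma_{op})})=\frac{\widehat AD_i}{\widehat A+D_i}\qquad\text{for all } i=1,\dots,m$$ tends to $1$ as $m\to\infty$. -/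

import Mathlib

open MeasureTheory ProbabilityTheory Filter Topology
open scoped NNReal ENNReal

noncomputable section

namespace FayHerriot

/-- Covariate and coefficient vectors, `ℝ^p` with its Euclidean structure. -/
abbrev Vec (p : ℕ) := EuclideanSpace ℝ (Fin p)

/-- The linear predictor `xᵀ β`. -/
def linPred {p : ℕ} (x β : Vec p) : ℝ := ∑ j, x j * β j

/-- The `N(μ, v)` density at `y`. -/
def normalDensity (μ v y : ℝ) : ℝ := gaussianPDFReal μ v.toNNReal y

/-- The normaliser `(∫ φ(t; μ, v)^(1+γ) dt)^(-γ/(1+γ))` of the `γ`-divergence. -/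
def integralNormaliser (γ μ v : ℝ) : ℝ :=
  (∫ t, normalDensity μ v t ^ (1 + γ)) ^ (-γ / (1 + γ))

/-- The closed-form weight `(2πv)^(γ²/(2(1+γ)))`; it differs from `integralNormaliser` by the
factor `(1+γ)^(γ/(2(1+γ)))`, which depends on `γ` alone. -/
def closedNormaliser (γ _μ v : ℝ) : ℝ :=
  (2 * Real.pi * v) ^ (γ ^ 2 / (2 * (1 + γ)))

/-- The generalised likelihood `𝒟_γ` of one observation `y` with marginal law `N(μ, v)`, formed
with the normaliser `c`; for `γ = 0` it is the marginal log-likelihood. -/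
def gammaLik (c : ℝ → ℝ → ℝ → ℝ) (γ μ v y : ℝ) : ℝ :=
  if γ = 0 then Real.log (normalDensity μ v y)
  else 1 / γ * normalDensity μ v y ^ γ * c γ μ v

/-- The robust posterior mean `y + D (d/dy) 𝒟_γ(y; ψ)`, where `ψ = (β, A)`. -/
def robustMean {p : ℕ} (c : ℝ → ℝ → ℝ → ℝ) (γ : ℝ) (ψ : Vec p × ℝ)
    (y : ℝ) (x : Vec p) (D : ℝ) : ℝ :=
  y + D * deriv (gammaLik c γ (linPred x ψ.1) (ψ.2 + D)) y

/-- The robust posterior variance `D + D² (d²/dy²) 𝒟_γ(y; ψ)`, where `ψ = (β, A)`. -/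
def robustVar {p : ℕ} (c : ℝ → ℝ → ℝ → ℝ) (γ : ℝ) (ψ : Vec p × ℝ)
    (y : ℝ) (x : Vec p) (D : ℝ) : ℝ :=
  D + D ^ 2 * iteratedDeriv 2 (gammaLik c γ (linPred x ψ.1) (ψ.2 + D)) y

/-- The posterior mean of `θ` given `y` in the normal model with parameter `ψ = (β, A)`. -/
def bayesMean {p : ℕ} (ψ : Vec p × ℝ) (y : ℝ) (x : Vec p) (D : ℝ) : ℝ :=
  y - D / (ψ.2 + D) * (y - linPred x ψ.1)

/-- The posterior variance of `θ` given `y` in the normal model with variance `A`. -/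
def bayesVar (A D : ℝ) : ℝ := A * D / (A + D)

section Sample

variable {Ω : Type*} {p : ℕ}

/-- The objective `∑_{i < m} 𝒟_γ(y_i; ψ)` built from the first `m` areas. -/
def objective (c : ℝ → ℝ → ℝ → ℝ) (y : ℕ → Ω → ℝ) (x : ℕ → Ω → Vec p) (D : ℕ → Ω → ℝ)
    (m : ℕ) (γ : ℝ) (ω : Ω) (ψ : Vec p × ℝ) : ℝ :=
  ∑ i ∈ Finset.range m, gammaLik c γ (linPred (x i ω) ψ.1) (ψ.2 + D i ω) (y i ω)

/-- The total robust posterior variance of the first `m` areas, at the parameter value `ψ`. -/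
def totalVar (c : ℝ → ℝ → ℝ → ℝ) (y : ℕ → Ω → ℝ) (x : ℕ → Ω → Vec p) (D : ℕ → Ω → ℝ)
    (m : ℕ) (γ : ℝ) (ω : Ω) (ψ : Vec p × ℝ) : ℝ :=
  ∑ i ∈ Finset.range m, robustVar c γ ψ (y i ω) (x i ω) (D i ω)

variable [MeasurableSpace Ω]

/-- `ψhat m γ` is, almost surely, a maximiser over `Ψ` of the objective, for every number of
areas `m` and every candidate `γ ∈ Γ`. -/
def IsRobustEstimator (P : Measure Ω) (c : ℝ → ℝ → ℝ → ℝ)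
    (y : ℕ → Ω → ℝ) (x : ℕ → Ω → Vec p) (D : ℕ → Ω → ℝ)
    (Ψ : Set (Vec p × ℝ)) (Γ : Finset ℝ) (ψhat : ℕ → ℝ → Ω → Vec p × ℝ) : Prop :=
  ∀ m, ∀ γ ∈ Γ, ∀ᵐ ω ∂P,
    ψhat m γ ω ∈ Ψ ∧ IsMaxOn (objective c y x D m γ ω) Ψ (ψhat m γ ω)

/-- `γop m` is, almost surely, a minimiser over the grid `Γ` of the total estimated robust
posterior variance, for every number of areas `m`. -/
def IsSelected (P : Measure Ω) (c : ℝ → ℝ → ℝ → ℝ)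
    (y : ℕ → Ω → ℝ) (x : ℕ → Ω → Vec p) (D : ℕ → Ω → ℝ)
    (Γ : Finset ℝ) (ψhat : ℕ → ℝ → Ω → Vec p × ℝ) (γop : ℕ → Ω → ℝ) : Prop :=
  ∀ m, ∀ᵐ ω ∂P,
    γop m ω ∈ Γ ∧ IsMinOn (fun γ => totalVar c y x D m γ ω (ψhat m γ ω)) Γ (γop m ω)

/-- The Fay–Herriot model with true parameter `ψstar = (β, A)`: conditionally on `(x_i, D_i)`,
`θ_i` is `N(x_iᵀ β, A)`, and conditionally on `(θ_i, x_i, D_i)`, `y_i` is `N(θ_i, D_i)`. -/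
structure CorrectlySpecified (P : Measure Ω) [IsFiniteMeasure P]
    (θ y : ℕ → Ω → ℝ) (x : ℕ → Ω → Vec p) (D : ℕ → Ω → ℝ) (ψstar : Vec p × ℝ) : Prop where
  measurable_θ : ∀ i, Measurable (θ i)
  law_θ : ∀ i, ∀ᵐ ω ∂P,
    condDistrib (θ i) (fun ω => (x i ω, D i ω)) P (x i ω, D i ω)
      = gaussianReal (linPred (x i ω) ψstar.1) ψstar.2.toNNReal
  law_y : ∀ i, ∀ᵐ ω ∂P,
    condDistrib (y i) (fun ω => (θ i ω, x i ω, D i ω)) P (θ i ω, x i ω, D i ω)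
      = gaussianReal (θ i ω) (D i ω).toNNReal

/-- The triples `(y_i, x_i, D_i)` are i.i.d. and `0 < D_L ≤ D_i ≤ D_U`. -/
structure SamplingCondition (P : Measure Ω)
    (y : ℕ → Ω → ℝ) (x : ℕ → Ω → Vec p) (D : ℕ → Ω → ℝ) (DL DU : ℝ) : Prop where
  measurable_y : ∀ i, Measurable (y i)
  measurable_x : ∀ i, Measurable (x i)
  measurable_D : ∀ i, Measurable (D i)
  indep : iIndepFun (fun i ω => (y i ω, x i ω, D i ω)) P
  ident : ∀ i, IdentDistrib (fun ω => (y i ω, x i ω, D i ω)) (fun ω => (y 0 ω, x 0 ω, D 0 ω)) P P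
  DL_pos : 0 < DL
  D_mem : ∀ i, ∀ᵐ ω ∂P, D i ω ∈ Set.Icc DL DU

/-- The covariates lie in a bounded set and `E[x_i x_iᵀ]` is positive definite. -/
structure CovariateCondition (P : Measure Ω) (x : ℕ → Ω → Vec p) : Prop where
  bounded : ∃ 𝒳 : Set (Vec p), Bornology.IsBounded 𝒳 ∧ ∀ i, ∀ᵐ ω ∂P, x i ω ∈ 𝒳
  posDef : ∀ i, (Matrix.of fun j k : Fin p => ∫ ω, x i ω j * x i ω k ∂P).PosDef

end Sample

/-- `Ψ ⊆ ℝ^p × (0, ∞)` is compact and contains the true parameter `ψstar = (β, A)`, and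
`A + D_L > (2π)⁻¹ e⁻³`. -/
structure ParameterCondition {p : ℕ} (Ψ : Set (Vec p × ℝ)) (ψstar : Vec p × ℝ) (DL : ℝ) :
    Prop where
  compact : IsCompact Ψ
  pos : ∀ ψ ∈ Ψ, 0 < ψ.2
  true_mem : ψstar ∈ Ψ
  lower : (2 * Real.pi)⁻¹ * Real.exp (-3) < ψstar.2 + DL

/-- A grid `0 = γ_1 < γ_2 < ⋯ < γ_M = 1`. -/
structure IsGrid (Γ : Finset ℝ) : Prop where
  zero_mem : 0 ∈ Γ
  one_mem : 1 ∈ Γ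
  subset : ∀ γ ∈ Γ, γ ∈ Set.Icc (0 : ℝ) 1

end FayHerriot

end

/-! Under correct specification every $\mathcal D_\gamma$ is a strictly proper score for the normal
family: its expectation under $N(m,s)$ has the unique maximiser $(m,s)$ (`strictlyProper_logLik`,
`strictlyProper_powLik`). Since $E[xx^\top]$ is positive definite, the expected objective has the
unique maximiser $\psi_*$ on $\Psi$ (`integral_paramMap_lt`). So all the estimators, robust or not,
converge to the same $\psi_*$. A strong law in the Banach space $C(\Psi,\mathbb R)$ gives uniform
convergence of the objective and of the average posterior variance, and the latter, evaluated at
$\widehat\psi^{(\gamma)}$, tends almost surely to its expectation at $\psi_*$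
(`ae_tendsto_average_totalVar`).

It remains to compare these limits. With $v=A_*+D$, the limit is $E[D-D^2/v]$ for $\gamma=0$ and
$E[D-D^2\,w_\gamma(v)(1+\gamma)^{-3/2}/v]$ for $\gamma>0$, where $w_\gamma$ is `weight`
(`integral_powLikDeriv2`). The lower bound on $A_*+D_L$ yields $w_\gamma(v)<(1+\gamma)^{3/2}$
(`weight_lt`), so $\gamma=0$ has the strictly smallest limit. The grid being finite, almost surely
$\gamma_{op}=0$ for all large $m$. This is stronger than convergence in probability and requires no
measurability of the estimators or of the selector. -/

namespace FayHerriot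

/-! ### General facts on almost sure convergence -/

/-- A sequence of (not necessarily measurable) events that almost surely hold eventually has
probability tending to one. -/
lemma tendsto_measure_of_ae_eventually {Ω : Type*} [MeasurableSpace Ω] {P : Measure Ω}
    [IsProbabilityMeasure P] {S : ℕ → Set Ω} (h : ∀ᵐ ω ∂P, ∀ᶠ m in atTop, ω ∈ S m) :
    Tendsto (fun m => P (S m)) atTop (𝓝 1) := by
  -- The tails $\bigcap_{m\ge n}S_m$ increase in $n$, and continuity along increasing unions holds
  -- for arbitrary sets, measurable or not.
  have hmono : Monotone fun n => ⋂ m ≥ n, S m := fun a b hab =>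
    Set.iInter₂_mono' fun m hm => ⟨m, hab.trans hm, subset_rfl⟩
  have huniv : P (⋃ n, ⋂ m ≥ n, S m) = 1 := by
    rw [← measure_univ (μ := P)]
    refine measure_congr (eventuallyEq_univ.2 ?_)
    filter_upwards [h] with ω hω
    obtain ⟨n, hn⟩ := eventually_atTop.1 hω
    exact Set.mem_iUnion.2 ⟨n, Set.mem_iInter₂.2 hn⟩
  have hlim := tendsto_measure_iUnion_atTop (μ := P) hmono
  rw [huniv] at hlim
  exact tendsto_of_tendsto_of_tendsto_of_le_of_le hlim tendsto_const_nhds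
    (fun n => measure_mono (Set.iInter₂_subset n le_rfl)) fun n => prob_le_one

/-- Uniform strong law of large numbers for a function depending continuously on a parameter in a
compact space. -/
lemma ae_tendsto_average_continuousMap {Ω S K : Type*} [MeasurableSpace Ω] {P : Measure Ω}
    [TopologicalSpace S] [MeasurableSpace S] [BorelSpace S] [SecondCountableTopology S]
    [TopologicalSpace.PseudoMetrizableSpace S]
    [TopologicalSpace K] [CompactSpace K] {X : ℕ → Ω → S}
    (hindep : iIndepFun X P) (hident : ∀ i, IdentDistrib (X i) (X 0) P P)
    (F : C(S, C(K, ℝ))) (hF : Integrable (fun ω => F (X 0 ω)) P) :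
    ∀ᵐ ω ∂P, Tendsto (fun n : ℕ => (n : ℝ)⁻¹ • ∑ i ∈ Finset.range n, F (X i ω)) atTop
      (𝓝 (∫ ω, F (X 0 ω) ∂P)) := by
  let _ : MeasurableSpace C(K, ℝ) := borel _
  have : BorelSpace C(K, ℝ) := ⟨rfl⟩
  have hFm : Measurable F := F.continuous.measurable
  -- Convergence in the sup norm of $C(K,\mathbb R)$ is uniform convergence in the parameter, so the
  -- Banach-valued strong law suffices.
  refine strong_law_ae (fun i ω => F (X i ω)) hF (fun i j hij => ?_) fun i => (hident i).comp hFm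
  exact (hindep.indepFun hij).comp hFm hFm

/-- If objectives converge uniformly on a compact space to a limit with unique maximiser `a`, then
uniformly convergent functions evaluated at maximisers converge to their limit at `a`. -/
lemma tendsto_eval_argmax {K : Type*} [TopologicalSpace K] [CompactSpace K]
    {G H : ℕ → C(K, ℝ)} {G₀ H₀ : C(K, ℝ)} (hG : Tendsto G atTop (𝓝 G₀))
    (hH : Tendsto H atTop (𝓝 H₀)) {a : K} (ha : ∀ b, b ≠ a → G₀ b < G₀ a) {u : ℕ → K}
    (hu : ∀ n b, G n b ≤ G n (u n)) : Tendsto (fun n => H n (u n)) atTop (𝓝 (H₀ a)) := by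
  have hua : Tendsto u atTop (𝓝 a) := by
    rw [(nhds_basis_opens a).tendsto_right_iff]
    rintro U ⟨haU, hU⟩
    rcases (Uᶜ).eq_empty_or_nonempty with hE | hne
    · exact Eventually.of_forall fun n => by
        rw [Set.compl_empty_iff.1 hE]; trivial
    obtain ⟨b, hb, hbmax⟩ := hU.isClosed_compl.isCompact.exists_isMaxOn hne G₀.continuous.continuousOn
    -- Off the neighbourhood $U$ the limit stays at least the gap $G_0(a)-G_0(b)$ below its maximum.
    -- Uniform error under half this gap forces the maximiser into $U$.
    have hlt : G₀ b < G₀ a := ha b fun h => hb (h ▸ haU)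
    have hε : 0 < (G₀ a - G₀ b) / 2 := by linarith
    filter_upwards [(Metric.tendsto_nhds.1 hG) _ hε] with n hn
    by_contra hnU
    have h1 := hbmax (show u n ∈ Uᶜ from hnU)
    have h2 := (abs_lt.1 ((ContinuousMap.dist_apply_le_dist a).trans_lt hn))
    have h3 := (abs_lt.1 ((ContinuousMap.dist_apply_le_dist (u n)).trans_lt hn))
    have h4 := hu n a
    simp only [Set.mem_ofPred_eq] at h1
    linarith [h2.1, h3.2]
  have h1 : Tendsto (fun n => H₀ (u n)) atTop (𝓝 (H₀ a)) := (H₀.continuous.tendsto a).comp hua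
  refine h1.congr_dist (squeeze_zero (fun _ => dist_nonneg)
    (fun n => ContinuousMap.dist_apply_le_dist (u n)) ?_)
  simpa [dist_comm] using (tendsto_iff_dist_tendsto_zero.1 hH)

/-! ### The marginal law of the observations -/

/-- Disintegration along a family of conditional laws. -/
lemma lintegral_of_condDistrib_eq {Ω β : Type*} [MeasurableSpace Ω] [MeasurableSpace β]
    {P : Measure Ω} [IsFiniteMeasure P] {Y : Ω → ℝ} {X : Ω → β} (hY : Measurable Y)
    (hX : Measurable X) {η : β → Measure ℝ}
    (h : ∀ᵐ ω ∂P, condDistrib Y X P (X ω) = η (X ω)) {g : β × ℝ → ℝ≥0∞} (hg : Measurable g) :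
    ∫⁻ ω, g (X ω, Y ω) ∂P = ∫⁻ ω, ∫⁻ t, g (X ω, t) ∂(η (X ω)) ∂P := by
  have h1 : ∫⁻ ω, g (X ω, Y ω) ∂P = ∫⁻ z, g z ∂(P.map fun ω => (X ω, Y ω)) :=
    (lintegral_map hg (hX.prodMk hY)).symm
  rw [h1, ← compProd_map_condDistrib hY.aemeasurable, Measure.lintegral_compProd hg,
    lintegral_map (hg.lintegral_kernel_prod_right') hX]
  exact lintegral_congr_ae (h.mono fun ω hω => by simp only [hω])

lemma measurable_linPred {p : ℕ} (β : Vec p) : Measurable fun x : Vec p => linPred x β := by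
  unfold linPred; fun_prop

/-- The conditional law of an observation given its covariate and sampling variance. -/
noncomputable def marginalKernel {p : ℕ} (ψ : Vec p × ℝ) : Kernel (Vec p × ℝ) ℝ where
  toFun s := gaussianReal (linPred s.1 ψ.1) (ψ.2.toNNReal + s.2.toNNReal)
  measurable' := by
    refine measurable_gaussianReal.comp (Measurable.prodMk ?_ ?_)
    · exact (measurable_linPred _).comp measurable_fst
    · fun_prop

instance {p : ℕ} (ψ : Vec p × ℝ) : IsMarkovKernel (marginalKernel ψ) :=
  ⟨fun s => by
    change IsProbabilityMeasure (gaussianReal _ _)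
    infer_instance⟩

/-- $N(s,b)$ is the translate of $N(0,b)$ by $s$, so mixing over $s$ is a convolution and the
variances add. -/
lemma lintegral_gaussianReal_gaussianReal (μ : ℝ) (a b : ℝ≥0) {f : ℝ → ℝ≥0∞} (hf : Measurable f) :
    ∫⁻ s, ∫⁻ t, f t ∂(gaussianReal s b) ∂(gaussianReal μ a)
      = ∫⁻ t, f t ∂(gaussianReal μ (a + b)) := by
  have h := gaussianReal_conv_gaussianReal (m₁ := μ) (m₂ := 0) (v₁ := a) (v₂ := b)
  rw [add_zero] at h
  rw [← h, Measure.lintegral_conv hf]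
  refine lintegral_congr fun s => ?_
  have h' : gaussianReal s b = (gaussianReal 0 b).map (s + ·) := by
    rw [gaussianReal_map_const_add, zero_add]
  rw [h', lintegral_map hf (by fun_prop)]

/-- The joint law of covariate, sampling variance and observation. -/
lemma CorrectlySpecified.map_eq_compProd {Ω : Type*} [MeasurableSpace Ω] {P : Measure Ω}
    [IsFiniteMeasure P] {p : ℕ} {θ y : ℕ → Ω → ℝ} {x : ℕ → Ω → Vec p} {D : ℕ → Ω → ℝ}
    {ψ : Vec p × ℝ} (h : CorrectlySpecified P θ y x D ψ) (i : ℕ) (hy : Measurable (y i))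
    (hx : Measurable (x i)) (hD : Measurable (D i)) :
    P.map (fun ω => ((x i ω, D i ω), y i ω))
      = (P.map fun ω => (x i ω, D i ω)) ⊗ₘ marginalKernel ψ := by
  refine Measure.ext_of_lintegral _ fun g hg => ?_
  have hθ := h.measurable_θ i
  rw [lintegral_map hg (by fun_prop), Measure.lintegral_compProd hg,
    lintegral_map hg.lintegral_kernel_prod_right' (by fun_prop)]
  have hg' : Measurable fun z : (ℝ × Vec p × ℝ) × ℝ => g (z.1.2, z.2) := by fun_prop
  have step1 := lintegral_of_condDistrib_eq (P := P) hy (hθ.prodMk (hx.prodMk hD))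
    (η := fun s => gaussianReal s.1 s.2.2.toNNReal) (h.law_y i) hg'
  let κ : Kernel (ℝ × Vec p × ℝ) ℝ :=
    ⟨fun s => gaussianReal s.1 s.2.2.toNNReal,
      measurable_gaussianReal.comp (Measurable.prodMk (by fun_prop) (by fun_prop))⟩
  have : IsMarkovKernel κ := ⟨fun s => by
    change IsProbabilityMeasure (gaussianReal _ _)
    infer_instance⟩
  have hinner : Measurable fun z : (Vec p × ℝ) × ℝ =>
      ∫⁻ t, g (z.1, t) ∂(gaussianReal z.2 z.1.2.toNNReal) := by
    have := hg'.lintegral_kernel_prod_right' (κ := κ)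
    exact this.comp (f := fun z : (Vec p × ℝ) × ℝ => (z.2, z.1)) (by fun_prop)
  have step2 := lintegral_of_condDistrib_eq (P := P) hθ (hx.prodMk hD)
    (η := fun s => gaussianReal (linPred s.1 ψ.1) ψ.2.toNNReal) (h.law_θ i) hinner
  -- First $y$ is integrated out given $(\theta,x,D)$, then $\theta$ given $(x,D)$; the resulting
  -- Gaussian mixture is the marginal $N(x^\top\beta,A+D)$.
  refine step1.trans (step2.trans (lintegral_congr fun ω => ?_))
  exact lintegral_gaussianReal_gaussianReal (linPred (x i ω) ψ.1) ψ.2.toNNReal (D i ω).toNNReal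
    (f := fun t => g ((x i ω, D i ω), t)) (hg.comp measurable_prodMk_left)

/-! ### Closed forms of the generalised likelihood -/

/-- The normal log-likelihood as a function of mean, variance and observation. -/
noncomputable def logLik (μ v y : ℝ) : ℝ :=
  -(1 / 2) * Real.log (2 * Real.pi * v) - (y - μ) ^ 2 / (2 * v)

/-- The factor `κ (2πv)^(-γ/(2(1+γ)))` of the `γ`-likelihood. -/
noncomputable def weight (κ γ v : ℝ) : ℝ := κ * (2 * Real.pi * v) ^ (-γ / (2 * (1 + γ)))

/-- The closed form of the `γ`-likelihood for `γ > 0`. -/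
noncomputable def powLik (κ γ μ v y : ℝ) : ℝ :=
  weight κ γ v / γ * Real.exp (-γ * (y - μ) ^ 2 / (2 * v))

/-- The second derivative of `powLik` in the observation. -/
noncomputable def powLikDeriv2 (κ γ μ v y : ℝ) : ℝ :=
  weight κ γ v * (γ * (y - μ) ^ 2 / v ^ 2 - 1 / v) * Real.exp (-γ * (y - μ) ^ 2 / (2 * v))

lemma weight_pos {κ γ v : ℝ} (hκ : 0 < κ) (hv : 0 < v) : 0 < weight κ γ v := by
  unfold weight
  have := Real.pi_pos
  positivity

lemma normalDensity_eq {μ v : ℝ} (hv : 0 < v) (y : ℝ) :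
    normalDensity μ v y = (2 * Real.pi * v) ^ (-(1 / 2) : ℝ) * Real.exp (-(y - μ) ^ 2 / (2 * v)) := by
  have := Real.pi_pos
  rw [normalDensity, gaussianPDFReal, Real.coe_toNNReal v hv.le, Real.rpow_neg (by positivity),
    Real.sqrt_eq_rpow]

lemma normalDensity_rpow {μ v : ℝ} (hv : 0 < v) (y a : ℝ) :
    normalDensity μ v y ^ a
      = (2 * Real.pi * v) ^ (-(1 / 2) * a) * Real.exp (-a * (y - μ) ^ 2 / (2 * v)) := by
  have := Real.pi_pos
  rw [normalDensity_eq hv, Real.mul_rpow (by positivity) (Real.exp_pos _).le,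
    ← Real.rpow_mul (by positivity), ← Real.exp_mul]
  congr 2
  ring

lemma gammaLik_zero (c : ℝ → ℝ → ℝ → ℝ) {μ v : ℝ} (hv : 0 < v) :
    gammaLik c 0 μ v = logLik μ v := by
  have := Real.pi_pos
  ext y
  rw [gammaLik, if_pos rfl, normalDensity_eq hv, Real.log_mul (by positivity) (Real.exp_pos _).ne',
    Real.log_rpow (by positivity), Real.log_exp, logLik]
  ring

lemma integral_normalDensity_rpow {γ μ v : ℝ} (hγ : 0 < γ) (hv : 0 < v) :
    ∫ t, normalDensity μ v t ^ (1 + γ)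
      = (2 * Real.pi * v) ^ (-γ / 2) * (1 + γ) ^ (-(1 / 2) : ℝ) := by
  have hπ := Real.pi_pos
  simp_rw [normalDensity_rpow hv]
  rw [integral_const_mul]
  have h1 : ∀ t : ℝ, -(1 + γ) * (t - μ) ^ 2 / (2 * v) = -((1 + γ) / (2 * v)) * (t - μ) ^ 2 :=
    fun t => by ring
  simp_rw [h1]
  rw [integral_sub_right_eq_self (fun t => Real.exp (-((1 + γ) / (2 * v)) * t ^ 2)) μ,
    integral_gaussian]
  have h2 : Real.pi / ((1 + γ) / (2 * v)) = (2 * Real.pi * v) * (1 + γ)⁻¹ := by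
    field_simp
  rw [h2, Real.sqrt_eq_rpow,
    Real.mul_rpow (by positivity : 0 ≤ 2 * Real.pi * v) (by positivity : 0 ≤ (1 + γ)⁻¹), ← mul_assoc,
    ← Real.rpow_add (by positivity), Real.inv_rpow (by positivity),
    Real.rpow_neg (by positivity : 0 ≤ 1 + γ)]
  congr 2
  ring

lemma integralNormaliser_eq {γ μ v : ℝ} (hγ : 0 < γ) (hv : 0 < v) :
    integralNormaliser γ μ v
      = (1 + γ) ^ (γ / (2 * (1 + γ))) * closedNormaliser γ μ v := by
  have hπ := Real.pi_pos
  rw [integralNormaliser, integral_normalDensity_rpow hγ hv, closedNormaliser,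
    Real.mul_rpow (by positivity) (by positivity), ← Real.rpow_mul (by positivity),
    ← Real.rpow_mul (by positivity), mul_comm]
  congr 2 <;> field_simp

/-- Both normalisers are absorbed into one constant $\kappa$. The stated upper bound is the value of
$\kappa$ for `integralNormaliser`; for `closedNormaliser` it is $1$, which is smaller. -/
lemma exists_gammaLik_eq_powLik {c : ℝ → ℝ → ℝ → ℝ}
    (hc : c = integralNormaliser ∨ c = closedNormaliser) {γ : ℝ} (hγ : 0 < γ) :
    ∃ κ : ℝ, 0 < κ ∧ κ ≤ (1 + γ) ^ (γ / (2 * (1 + γ))) ∧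
      ∀ μ v : ℝ, 0 < v → gammaLik c γ μ v = powLik κ γ μ v := by
  have hπ := Real.pi_pos
  have key : ∀ κ μ v : ℝ, 0 < v → c γ μ v = κ * closedNormaliser γ μ v →
      gammaLik c γ μ v = powLik κ γ μ v := by
    intro κ μ v hv h
    ext y
    rw [gammaLik, if_neg hγ.ne', normalDensity_rpow hv, h, closedNormaliser, powLik, weight]
    have : (2 * Real.pi * v) ^ (-γ / (2 * (1 + γ)))
        = (2 * Real.pi * v) ^ (-(1 / 2) * γ) * (2 * Real.pi * v) ^ (γ ^ 2 / (2 * (1 + γ))) := by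
      rw [← Real.rpow_add (by positivity)]
      congr 1
      field_simp
      ring
    rw [this]
    ring
  have hone : (1 : ℝ) ≤ (1 + γ) ^ (γ / (2 * (1 + γ))) :=
    Real.one_le_rpow (by linarith) (by positivity)
  rcases hc with rfl | rfl
  · exact ⟨_, by positivity, le_rfl, fun μ v hv => key _ μ v hv (integralNormaliser_eq hγ hv)⟩
  · exact ⟨1, one_pos, hone, fun μ v hv => key 1 μ v hv (one_mul _).symm⟩

lemma hasDerivAt_logLik {μ v : ℝ} (hv : 0 < v) (y : ℝ) :
    HasDerivAt (logLik μ v) (-(y - μ) / v) y := by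
  have h := ((((hasDerivAt_id y).sub_const μ).pow 2).div_const (2 * v)).const_sub
    (-(1 / 2) * Real.log (2 * Real.pi * v))
  refine h.congr_deriv ?_
  simp only [id]
  field_simp
  simp [mul_comm]

lemma deriv_logLik {μ v : ℝ} (hv : 0 < v) : deriv (logLik μ v) = fun y => -(y - μ) / v :=
  funext fun y => (hasDerivAt_logLik hv y).deriv

lemma iteratedDeriv_two_logLik {μ v : ℝ} (hv : 0 < v) :
    iteratedDeriv 2 (logLik μ v) = fun _ => -1 / v := by
  rw [iteratedDeriv_succ, iteratedDeriv_one, deriv_logLik hv]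
  ext y
  exact ((((hasDerivAt_id y).sub_const μ).neg).div_const v).deriv

lemma hasDerivAt_exp_neg_sq (γ μ v y : ℝ) :
    HasDerivAt (fun y => Real.exp (-γ * (y - μ) ^ 2 / (2 * v)))
      (Real.exp (-γ * (y - μ) ^ 2 / (2 * v)) * (-γ * (y - μ) / v)) y := by
  have h := (((((hasDerivAt_id y).sub_const μ).pow 2).const_mul (-γ)).div_const (2 * v)).exp
  refine h.congr_deriv ?_
  simp only [id]
  congr 1
  -- At $v=0$ division by zero returns $0$, so the function is constant and the claimed derivative
  -- vanishes.
  by_cases hv : v = 0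
  · simp [hv]
  · simp
    field_simp

lemma iteratedDeriv_two_powLik {κ γ μ v : ℝ} (hγ : 0 < γ) (hv : 0 < v) :
    iteratedDeriv 2 (powLik κ γ μ v) = powLikDeriv2 κ γ μ v := by
  have h1 : deriv (powLik κ γ μ v) = fun y => weight κ γ v / γ *
      (Real.exp (-γ * (y - μ) ^ 2 / (2 * v)) * (-γ * (y - μ) / v)) :=
    funext fun y => ((hasDerivAt_exp_neg_sq γ μ v y).const_mul _).deriv
  rw [iteratedDeriv_succ, iteratedDeriv_one, h1]
  ext y
  have h2 := (((hasDerivAt_exp_neg_sq γ μ v y).mul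
    ((((hasDerivAt_id y).sub_const μ).const_mul (-γ)).div_const v)).const_mul (weight κ γ v / γ))
  refine h2.deriv.trans ?_
  simp only [id, powLikDeriv2]
  field_simp
  ring

/-! ### Gaussian integrals -/

/-- Completing the square in $t$. Consequently an exponentially tilted Gaussian expectation is a
multiple of an expectation under another Gaussian, and only first and second moments are ever
needed. -/
lemma gaussianPDFReal_mul_exp {γ m s μ v : ℝ} (hγ : 0 < γ) (hs : 0 < s) (hv : 0 < v) (t : ℝ) :
    gaussianPDFReal m s.toNNReal t * Real.exp (-γ * (t - μ) ^ 2 / (2 * v))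
      = √(v / (v + γ * s)) * Real.exp (-γ * (m - μ) ^ 2 / (2 * (v + γ * s)))
        * gaussianPDFReal ((v * m + γ * s * μ) / (v + γ * s)) (s * v / (v + γ * s)).toNNReal t := by
  have hπ := Real.pi_pos
  have hd : 0 < v + γ * s := by positivity
  have hs' : 0 < s * v / (v + γ * s) := by positivity
  rw [gaussianPDFReal, gaussianPDFReal, Real.coe_toNNReal _ hs.le, Real.coe_toNNReal _ hs'.le]
  have h1 : (√(2 * Real.pi * s))⁻¹
      = √(v / (v + γ * s)) * (√(2 * Real.pi * (s * v / (v + γ * s))))⁻¹ := by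
    have : 2 * Real.pi * (s * v / (v + γ * s)) = (v / (v + γ * s)) * (2 * Real.pi * s) := by ring
    have h0 : √(v / (v + γ * s)) ≠ 0 := (Real.sqrt_pos.2 (by positivity)).ne'
    rw [this, Real.sqrt_mul (by positivity : 0 ≤ v / (v + γ * s)) (2 * Real.pi * s), mul_inv, ← mul_assoc, mul_inv_cancel₀ h0, one_mul]
  rw [h1, mul_assoc, ← Real.exp_add]
  have h2 : -(t - m) ^ 2 / (2 * s) + -γ * (t - μ) ^ 2 / (2 * v)
      = -γ * (m - μ) ^ 2 / (2 * (v + γ * s)) +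
        -(t - (v * m + γ * s * μ) / (v + γ * s)) ^ 2 / (2 * (s * v / (v + γ * s))) := by
    field_simp
    ring
  rw [h2, Real.exp_add]
  ring

lemma integral_gaussianReal_exp_mul {γ m s μ v : ℝ} (hγ : 0 < γ) (hs : 0 < s) (hv : 0 < v)
    (h : ℝ → ℝ) :
    ∫ t, Real.exp (-γ * (t - μ) ^ 2 / (2 * v)) * h t ∂(gaussianReal m s.toNNReal)
      = √(v / (v + γ * s)) * Real.exp (-γ * (m - μ) ^ 2 / (2 * (v + γ * s))) *
        ∫ t, h t ∂(gaussianReal ((v * m + γ * s * μ) / (v + γ * s))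
          (s * v / (v + γ * s)).toNNReal) := by
  have hs' : 0 < s * v / (v + γ * s) := by positivity
  rw [integral_gaussianReal_eq_integral_smul (Real.toNNReal_pos.2 hs).ne',
    integral_gaussianReal_eq_integral_smul (Real.toNNReal_pos.2 hs').ne', ← integral_const_mul]
  refine integral_congr_ae (Eventually.of_forall fun t => ?_)
  simp only [smul_eq_mul]
  rw [← mul_assoc, gaussianPDFReal_mul_exp hγ hs hv, mul_assoc]

lemma integrable_sq_gaussianReal (m : ℝ) (s : ℝ≥0) :
    Integrable (fun t => t ^ 2) (gaussianReal m s) :=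
  (memLp_id_gaussianReal' (μ := m) (v := s) 2 (by simp)).integrable_sq

lemma integrable_sub_sq_gaussianReal (m : ℝ) (s : ℝ≥0) (a : ℝ) :
    Integrable (fun t => (t - a) ^ 2) (gaussianReal m s) :=
  ((memLp_id_gaussianReal' (μ := m) (v := s) 2 (by simp)).sub (memLp_const a)).integrable_sq

lemma integral_sub_sq_gaussianReal (m : ℝ) (s : ℝ≥0) (a : ℝ) :
    ∫ t, (t - a) ^ 2 ∂(gaussianReal m s) = s + (m - a) ^ 2 := by
  have hid : Integrable (fun t : ℝ => t) (gaussianReal m s) :=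
    (memLp_id_gaussianReal' (μ := m) (v := s) 1 (by simp)).integrable le_rfl
  have hvar := variance_fun_id_gaussianReal (μ := m) (v := s)
  rw [variance_eq_integral (by fun_prop), integral_id_gaussianReal] at hvar
  have h1 : ∀ t : ℝ, (t - a) ^ 2 = (t - m) ^ 2 + (2 * (m - a) * t + ((m - a) ^ 2 - 2 * (m - a) * m)) :=
    fun t => by ring
  have hlin : Integrable (fun t => 2 * (m - a) * t + ((m - a) ^ 2 - 2 * (m - a) * m))
      (gaussianReal m s) := (hid.const_mul _).add (integrable_const _)
  rw [funext h1, integral_add (integrable_sub_sq_gaussianReal m s m) hlin,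
    integral_add (hid.const_mul _) (integrable_const _), integral_const_mul, integral_id_gaussianReal,
    hvar]
  simp

/-! ### Propriety of the generalised likelihood -/

/-- A score is strictly proper for the normal family if its expectation under `N(m, s)` is
uniquely maximised at `(m, s)`. -/
def StrictlyProper (L : ℝ → ℝ → ℝ → ℝ) : Prop :=
  ∀ μ v m s : ℝ, 0 < v → 0 < s → (μ, v) ≠ (m, s) →
    ∫ t, L μ v t ∂(gaussianReal m s.toNNReal) < ∫ t, L m s t ∂(gaussianReal m s.toNNReal)

lemma integral_logLik {μ v m s : ℝ} (hs : 0 < s) :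
    ∫ t, logLik μ v t ∂(gaussianReal m s.toNNReal)
      = -(1 / 2) * Real.log (2 * Real.pi * v) - (s + (m - μ) ^ 2) / (2 * v) := by
  unfold logLik
  rw [integral_sub (integrable_const _) ((integrable_sub_sq_gaussianReal _ _ _).div_const _),
    integral_div, integral_sub_sq_gaussianReal, Real.coe_toNNReal _ hs.le]
  simp

/-- Positivity of the Kullback–Leibler divergence, here reduced to $\log r<r-1$ with $r=s/v\ne1$; if
$v=s$, the squared mean difference is decisive. -/
lemma strictlyProper_logLik : StrictlyProper logLik := by
  intro μ v m s hv hs hne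
  have hπ := Real.pi_pos
  rw [integral_logLik hs, integral_logLik hs, Real.log_mul (by positivity) hv.ne',
    Real.log_mul (by positivity) hs.ne']
  have hss : (s + (m - m) ^ 2) / (2 * s) = 1 / 2 := by
    simp; field_simp
  have hlog : Real.log (s / v) = Real.log s - Real.log v := Real.log_div hs.ne' hv.ne'
  have hexp : (s + (m - μ) ^ 2) / (2 * v) = s / v / 2 + (m - μ) ^ 2 / (2 * v) := by
    field_simp
  rw [hss, hexp]
  by_cases h : v = s
  · subst h
    have hm : m - μ ≠ 0 := fun h => hne (by rw [sub_eq_zero.1 h])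
    have : 0 < (m - μ) ^ 2 / (2 * v) := by positivity
    have : v / v = 1 := div_self hv.ne'
    linarith
  · have h1 := Real.log_lt_sub_one_of_pos (div_pos hs hv)
      (fun h' => h ((div_eq_one_iff_eq hv.ne').1 h').symm)
    have : 0 ≤ (m - μ) ^ 2 / (2 * v) := by positivity
    linarith

lemma integral_powLik {κ γ μ v m s : ℝ} (hγ : 0 < γ) (hv : 0 < v) (hs : 0 < s) :
    ∫ t, powLik κ γ μ v t ∂(gaussianReal m s.toNNReal)
      = weight κ γ v / γ * (√(v / (v + γ * s)) *
        Real.exp (-γ * (m - μ) ^ 2 / (2 * (v + γ * s)))) := by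
  have h := integral_gaussianReal_exp_mul (μ := μ) (m := m) hγ hs hv (fun _ => 1)
  simp only [mul_one, integral_const, smul_eq_mul, probReal_univ] at h
  unfold powLik
  rw [integral_const_mul, h]

/-- After taking logarithms, the dependence on $v$ is $\frac12\{\frac1{1+\gamma}\log v-\log(v+\gamma
s)\}$ plus a mean penalty. Strict concavity of $\log$ with weights $\frac1{1+\gamma}$ on $v$ and
$\frac\gamma{1+\gamma}$ on $s$ makes $v=s$ the unique maximiser; the exponent of `weight` is what
produces these weights. -/
lemma strictlyProper_powLik {κ γ : ℝ} (hκ : 0 < κ) (hγ : 0 < γ) :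
    StrictlyProper (powLik κ γ) := by
  intro μ v m s hv hs hne
  have hπ := Real.pi_pos
  have hd : 0 < v + γ * s := by positivity
  have hd' : 0 < s + γ * s := by positivity
  have hw := weight_pos (γ := γ) hκ hv
  have hw' := weight_pos (γ := γ) hκ hs
  rw [integral_powLik hγ hv hs, integral_powLik hγ hs hs]
  have hlogw : ∀ u : ℝ, 0 < u → Real.log (weight κ γ u) = Real.log κ
      - γ / (2 * (1 + γ)) * (Real.log (2 * Real.pi) + Real.log u) := fun u hu => by
    rw [weight, Real.log_mul hκ.ne' (by positivity), Real.log_rpow (by positivity),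
      Real.log_mul (by positivity) hu.ne']
    ring
  have hsqrt : ∀ u : ℝ, 0 < u → Real.log √(u / (u + γ * s))
      = (Real.log u - Real.log (u + γ * s)) / 2 := fun u hu => by
    rw [Real.log_sqrt (by positivity), Real.log_div hu.ne' (by positivity)]
  rw [← Real.log_lt_log_iff (by positivity) (by positivity)]
  have hs1 : 0 < √(v / (v + γ * s)) := Real.sqrt_pos.2 (by positivity)
  have hs2 : 0 < √(s / (s + γ * s)) := Real.sqrt_pos.2 (by positivity)
  rw [Real.log_mul (by positivity) (by positivity), Real.log_mul (by positivity) (by positivity),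
    Real.log_mul (by positivity) (by positivity), Real.log_mul (by positivity) (by positivity),
    Real.log_div hw.ne' hγ.ne', Real.log_div hw'.ne' hγ.ne', Real.log_exp, Real.log_exp,
    hlogw v hv, hlogw s hs, hsqrt v hv, hsqrt s hs]
  have hzero : -γ * (m - m) ^ 2 / (2 * (s + γ * s)) = 0 := by simp
  have hneg : -γ * (m - μ) ^ 2 / (2 * (v + γ * s))
      = -(γ * (m - μ) ^ 2 / (2 * (v + γ * s))) := by ring
  have hg1 : s + γ * s = (1 + γ) * s := by ring
  rw [hzero, hneg, hg1, Real.log_mul (by positivity) hs.ne']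
  have hsplit : γ / (2 * (1 + γ)) = (γ / (1 + γ)) / 2 := by field_simp
  rw [hsplit]
  by_cases h : v = s
  · subst h
    have hm : m - μ ≠ 0 := fun h => hne (by rw [sub_eq_zero.1 h])
    have : 0 < γ * (m - μ) ^ 2 / (2 * (v + γ * v)) := by positivity
    rw [hg1, Real.log_mul (by positivity) hs.ne'] at *
    linarith
  · have hconc := strictConcaveOn_log_Ioi.2 (Set.mem_Ioi.2 hv) (Set.mem_Ioi.2 hs) h
      (by positivity : 0 < 1 / (1 + γ)) (by positivity : 0 < γ / (1 + γ)) (by field_simp)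
    simp only [smul_eq_mul] at hconc
    have hcomb : 1 / (1 + γ) * v + γ / (1 + γ) * s = (v + γ * s) / (1 + γ) := by ring
    rw [hcomb, Real.log_div hd.ne' (by positivity)] at hconc
    have hone : 1 / (1 + γ) = 1 - γ / (1 + γ) := by field_simp; ring
    rw [hone] at hconc
    have : 0 ≤ γ * (m - μ) ^ 2 / (2 * (v + γ * s)) := by positivity
    nlinarith

/-! ### Expected curvature -/

/-- The tilt shrinks the variance from $s$ to $s/(1+\gamma)$ and contributes the factor
$(1+\gamma)^{-1/2}$, while the bracket averages to $-1/\{(1+\gamma)s\}$. -/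
lemma integral_powLikDeriv2 {κ γ m s : ℝ} (hγ : 0 < γ) (hs : 0 < s) :
    ∫ t, powLikDeriv2 κ γ m s t ∂(gaussianReal m s.toNNReal)
      = -(weight κ γ s / ((1 + γ) * √(1 + γ))) / s := by
  have h := integral_gaussianReal_exp_mul (μ := m) (m := m) hγ hs hs
    (fun t => γ * (t - m) ^ 2 / s ^ 2 - 1 / s)
  have hm : (s * m + γ * s * m) / (s + γ * s) = m := by field_simp
  have hv : s * s / (s + γ * s) = s / (1 + γ) := by field_simp
  have hq : s / (s + γ * s) = (1 + γ)⁻¹ := by field_simp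
  have hv0 : 0 < s / (1 + γ) := by positivity
  rw [hm, hv, hq, integral_sub (((integrable_sub_sq_gaussianReal _ _ _).const_mul _).div_const _)
    (integrable_const _), integral_div, integral_const_mul, integral_sub_sq_gaussianReal,
    Real.coe_toNNReal _ hv0.le, Real.sqrt_inv] at h
  simp only [sub_self, integral_const, smul_eq_mul, probReal_univ] at h
  have hrw : ∀ t, powLikDeriv2 κ γ m s t = weight κ γ s *
      (Real.exp (-γ * (t - m) ^ 2 / (2 * s)) * (γ * (t - m) ^ 2 / s ^ 2 - 1 / s)) :=
    fun t => by rw [powLikDeriv2]; ring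
  simp_rw [hrw]
  rw [integral_const_mul, h]
  have : 0 < √(1 + γ) := Real.sqrt_pos.2 (by positivity)
  simp
  field_simp
  ring

/-- The place where $(2\pi)^{-1}e^{-3}$ enters. With $\log(2\pi v)>-3$ and the bound on $\kappa$, it
suffices that $3\gamma\le(3+2\gamma)\log(1+\gamma)$. The two sides agree to first order at
$\gamma=0$, which explains the constant $3$. -/
lemma weight_lt {κ γ v : ℝ} (hγ : 0 < γ) (hκ : 0 < κ)
    (hκ' : κ ≤ (1 + γ) ^ (γ / (2 * (1 + γ)))) (hv : 0 < v)
    (hv' : (2 * Real.pi)⁻¹ * Real.exp (-3) < v) : weight κ γ v < (1 + γ) * √(1 + γ) := by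
  have hπ := Real.pi_pos
  have hs : 0 < √(1 + γ) := Real.sqrt_pos.2 (by positivity)
  have hlv : -3 < Real.log (2 * Real.pi * v) := by
    rw [Real.lt_log_iff_exp_lt (by positivity)]
    have := mul_lt_mul_of_pos_left hv' (by positivity : 0 < 2 * Real.pi)
    rwa [mul_inv_cancel_left₀ (by positivity)] at this
  have hlκ : Real.log κ ≤ γ / (2 * (1 + γ)) * Real.log (1 + γ) := by
    rw [← Real.log_rpow (by positivity)]
    exact Real.log_le_log hκ hκ'
  have hlog := Real.le_log_one_add_of_nonneg hγ.le
  rw [← Real.log_lt_log_iff (weight_pos hκ hv) (by positivity), weight,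
    Real.log_mul hκ.ne' (by positivity), Real.log_rpow (by positivity),
    Real.log_mul (by positivity) hs.ne', Real.log_sqrt (by positivity)]
  have hl3 : 3 * γ ≤ Real.log (1 + γ) * (3 + 2 * γ) := by
    -- Chained with $\log(1+\gamma)\ge 2\gamma/(\gamma+2)$; the cross-multiplied difference is
    -- $\gamma^2$.
    have h1 : 3 * γ / (3 + 2 * γ) ≤ 2 * γ / (γ + 2) := by
      rw [div_le_div_iff₀ (by positivity) (by positivity)]
      nlinarith [sq_nonneg γ]
    exact (div_le_iff₀ (by positivity)).1 (h1.trans hlog)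
  set l := Real.log (1 + γ)
  set w := Real.log (2 * Real.pi * v)
  have hb : γ / (2 * (1 + γ)) * l + -γ / (2 * (1 + γ)) * w < l + l / 2 := by
    have : γ / (2 * (1 + γ)) * l + -γ / (2 * (1 + γ)) * w = (γ * l - γ * w) / (2 * (1 + γ)) := by
      ring
    rw [this, div_lt_iff₀ (by positivity)]
    nlinarith [mul_lt_mul_of_pos_left hlv hγ]
  linarith

/-! ### Uniform law of large numbers in the Fay–Herriot model -/

/-- A function of `q = (D, μ, v)` and an observation which is continuous for `v > 0` and grows at
most quadratically in the observation, locally uniformly in `q`. -/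
structure QuadraticGrowth (f : ℝ × ℝ × ℝ → ℝ → ℝ) : Prop where
  cont : ContinuousOn (fun z : (ℝ × ℝ × ℝ) × ℝ => f z.1 z.2) {z | 0 < z.1.2.2}
  bound : ∃ C : ℝ × ℝ × ℝ → ℝ, ContinuousOn C {q | 0 < q.2.2} ∧
    ∀ q y, 0 < q.2.2 → |f q y| ≤ C q * (1 + y ^ 2)

/-- Sampling variance (truncated from below at `d`), marginal mean and marginal variance. -/
noncomputable def arg {p : ℕ} (d : ℝ) (s : Vec p × ℝ) (ψ : Vec p × ℝ) : ℝ × ℝ × ℝ :=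
  (max s.2 d, linPred s.1 ψ.1, ψ.2 + max s.2 d)

lemma continuous_arg {p : ℕ} (d : ℝ) :
    Continuous fun z : (Vec p × ℝ) × (Vec p × ℝ) => arg d z.1 z.2 := by
  unfold arg linPred
  fun_prop

/-- Truncation is harmless since $D_i\ge D_L$ almost surely; it keeps the variance positive at every
sample point, so that `paramMap` is defined and continuous everywhere. -/
lemma arg_of_le {p : ℕ} {d : ℝ} {x : Vec p} {D : ℝ} (h : d ≤ D) (ψ : Vec p × ℝ) :
    arg d (x, D) ψ = (D, linPred x ψ.1, ψ.2 + D) := by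
  simp [arg, max_eq_left h]

section Model

variable {Ω : Type*} [MeasurableSpace Ω] {P : Measure Ω} [IsProbabilityMeasure P]
  {p : ℕ} {θ y : ℕ → Ω → ℝ} {x : ℕ → Ω → Vec p} {D : ℕ → Ω → ℝ}
  {ψstar : Vec p × ℝ} {Ψ : Set (Vec p × ℝ)} {DL DU : ℝ}

/-- A function of quadratic growth as a continuous map from observations to continuous functions
of the parameter. -/
noncomputable def paramMap {f : ℝ × ℝ × ℝ → ℝ → ℝ} (hf : QuadraticGrowth f)
    (hΨ : ∀ ψ ∈ Ψ, 0 < ψ.2) (hDL : 0 < DL) : C(ℝ × Vec p × ℝ, C(Ψ, ℝ)) :=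
  ContinuousMap.curry ⟨fun z => f (arg DL z.1.2 z.2) z.1.1, by
    refine hf.cont.comp_continuous (f := fun z : (ℝ × Vec p × ℝ) × Ψ =>
      (arg DL z.1.2 z.2, z.1.1)) ?_ fun z => ?_
    · exact ((continuous_arg DL).comp (f := fun z : (ℝ × Vec p × ℝ) × Ψ => (z.1.2, z.2.1))
        (by fun_prop)).prodMk (by fun_prop)
    · have := hΨ z.2 z.2.2
      have := le_max_right z.1.2.2 DL
      simp only [arg, Set.mem_ofPred_eq]
      linarith⟩

lemma paramMap_apply {f : ℝ × ℝ × ℝ → ℝ → ℝ} (hf : QuadraticGrowth f)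
    (hΨ : ∀ ψ ∈ Ψ, 0 < ψ.2) (hDL : 0 < DL) (z : ℝ × Vec p × ℝ) (ψ : Ψ) :
    paramMap hf hΨ hDL z ψ = f (arg DL z.2 ψ) z.1 := rfl

lemma integrable_sq_obs (hmodel : CorrectlySpecified P θ y x D ψstar)
    (h1 : SamplingCondition P y x D DL DU) (h2 : CovariateCondition P x) :
    Integrable (fun ω => y 0 ω ^ 2) P := by
  have hy := h1.measurable_y 0
  have hx := h1.measurable_x 0
  have hD := h1.measurable_D 0
  obtain ⟨𝒳, h𝒳, hx𝒳⟩ := h2.bounded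
  have hlin : Continuous fun x : Vec p => linPred x ψstar.1 := by unfold linPred; fun_prop
  obtain ⟨B, hB⟩ := h𝒳.isCompact_closure.exists_bound_of_continuousOn hlin.continuousOn
  refine ⟨by fun_prop, ?_⟩
  rw [hasFiniteIntegral_iff_ofReal (Eventually.of_forall fun ω => sq_nonneg _)]
  have hg : Measurable fun z : (Vec p × ℝ) × ℝ => ENNReal.ofReal (z.2 ^ 2) := by fun_prop
  have hmap := congrArg (fun μ => ∫⁻ z, ENNReal.ofReal (z.2 ^ 2) ∂μ)
    (hmodel.map_eq_compProd 0 hy hx hD)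
  rw [lintegral_map hg (by fun_prop), Measure.lintegral_compProd hg,
    lintegral_map hg.lintegral_kernel_prod_right' (by fun_prop)] at hmap
  simp only at hmap
  rw [hmap]
  refine lt_of_le_of_lt (lintegral_mono_ae (g := fun _ => ENNReal.ofReal
    (ψstar.2.toNNReal + DU.toNNReal + B ^ 2)) ?_) (by simp)
  filter_upwards [hx𝒳 0, h1.D_mem 0] with ω hω hDω
  change ∫⁻ t, ENNReal.ofReal (t ^ 2) ∂(gaussianReal _ _) ≤ _
  rw [← ofReal_integral_eq_lintegral_ofReal (integrable_sq_gaussianReal _ _)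
    (Eventually.of_forall fun t => sq_nonneg t)]
  refine ENNReal.ofReal_le_ofReal ?_
  have h := integral_sub_sq_gaussianReal (linPred (x 0 ω) ψstar.1)
    (ψstar.2.toNNReal + (D 0 ω).toNNReal) 0
  simp only [sub_zero] at h
  rw [h]
  push_cast
  have hb := hB _ (subset_closure hω)
  rw [Real.norm_eq_abs] at hb
  have hD' : ((D 0 ω).toNNReal : ℝ) ≤ DU.toNNReal := Real.toNNReal_le_toNNReal hDω.2
  have := sq_le_sq' (abs_le.1 hb).1 (abs_le.1 hb).2
  linarith

/-- The growth constant is bounded on the compact set of closed covariate range, $[D_L,D_U]$ and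
$\Psi$, so the sup norm over $\Psi$ is at most a constant times $1+y^2$. -/
lemma integrable_paramMap (hmodel : CorrectlySpecified P θ y x D ψstar)
    (h1 : SamplingCondition P y x D DL DU) (h2 : CovariateCondition P x) [CompactSpace Ψ]
    {f : ℝ × ℝ × ℝ → ℝ → ℝ} (hf : QuadraticGrowth f) (hΨ : ∀ ψ ∈ Ψ, 0 < ψ.2) :
    Integrable (fun ω => paramMap hf hΨ h1.DL_pos (y 0 ω, x 0 ω, D 0 ω)) P := by
  have hy := h1.measurable_y 0
  have hx := h1.measurable_x 0
  have hD := h1.measurable_D 0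
  obtain ⟨𝒳, h𝒳, hx𝒳⟩ := h2.bounded
  obtain ⟨C, hC, hfC⟩ := hf.bound
  have hargpos : ∀ (s : Vec p × ℝ) (ψ : Ψ), 0 < (arg DL s ψ.1).2.2 := fun s ψ => by
    have := hΨ ψ ψ.2
    have := le_max_right s.2 DL
    have := h1.DL_pos
    simp only [arg]
    linarith
  have hCc : Continuous fun z : (Vec p × ℝ) × Ψ => C (arg DL z.1 z.2) := by
    refine hC.comp_continuous (f := fun z : (Vec p × ℝ) × Ψ => arg DL z.1 z.2) ?_
      fun z => hargpos z.1 z.2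
    exact (continuous_arg DL).comp (f := fun z : (Vec p × ℝ) × Ψ => (z.1, z.2.1)) (by fun_prop)
  obtain ⟨B, hB⟩ := ((h𝒳.isCompact_closure.prod (isCompact_Icc (a := DL) (b := DU))).prod
    (isCompact_univ (X := Ψ))).exists_bound_of_continuousOn hCc.continuousOn
  have hmeas : AEStronglyMeasurable
      (fun ω => paramMap hf hΨ h1.DL_pos (y 0 ω, x 0 ω, D 0 ω)) P :=
    (paramMap hf hΨ h1.DL_pos).continuous.comp_aestronglyMeasurable
      (hy.prodMk (hx.prodMk hD)).aestronglyMeasurable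
  refine Integrable.mono' (((integrable_const (1 : ℝ)).add
    (integrable_sq_obs hmodel h1 h2)).const_mul |B|) hmeas ?_
  filter_upwards [hx𝒳 0, h1.D_mem 0] with ω hω hDω
  refine (ContinuousMap.norm_le _ (by simp only [Pi.add_apply]; positivity)).2 fun ψ => ?_
  rw [paramMap_apply, Real.norm_eq_abs]
  refine (hfC _ _ (hargpos _ ψ)).trans ?_
  simp only [Pi.add_apply]
  refine mul_le_mul_of_nonneg_right ?_ (by positivity)
  have := hB ((x 0 ω, D 0 ω), ψ) ⟨⟨subset_closure hω, hDω⟩, trivial⟩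
  exact (le_abs_self _).trans (this.trans (le_abs_self _))

/-- Expectations of functions of quadratic growth, by conditioning on the covariate and the
sampling variance. -/
lemma integral_paramMap_apply (hmodel : CorrectlySpecified P θ y x D ψstar)
    (h1 : SamplingCondition P y x D DL DU) (h2 : CovariateCondition P x) [CompactSpace Ψ]
    {f : ℝ × ℝ × ℝ → ℝ → ℝ} (hf : QuadraticGrowth f) (hΨ : ∀ ψ ∈ Ψ, 0 < ψ.2)
    (hstar : 0 < ψstar.2) (ψ : Ψ) :
    Integrable (fun ω => ∫ t, f (D 0 ω, linPred (x 0 ω) ψ.1.1, ψ.1.2 + D 0 ω) t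
      ∂(gaussianReal (linPred (x 0 ω) ψstar.1) (ψstar.2 + D 0 ω).toNNReal)) P ∧
    (∫ ω, paramMap hf hΨ h1.DL_pos (y 0 ω, x 0 ω, D 0 ω) ∂P) ψ
      = ∫ ω, ∫ t, f (D 0 ω, linPred (x 0 ω) ψ.1.1, ψ.1.2 + D 0 ω) t
        ∂(gaussianReal (linPred (x 0 ω) ψstar.1) (ψstar.2 + D 0 ω).toNNReal) ∂P := by
  have hy := h1.measurable_y 0
  have hx := h1.measurable_x 0
  have hD := h1.measurable_D 0
  have hF := integrable_paramMap hmodel h1 h2 hf hΨ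
  have hFψ : Integrable (fun ω => paramMap hf hΨ h1.DL_pos (y 0 ω, x 0 ω, D 0 ω) ψ) P :=
    (ContinuousMap.evalCLM ℝ ψ).integrable_comp hF
  rw [ContinuousMap.integral_apply hF]
  let g : (Vec p × ℝ) × ℝ → ℝ := fun z => paramMap hf hΨ h1.DL_pos (z.2, z.1) ψ
  have hg : Continuous g :=
    (ContinuousMap.evalCLM ℝ ψ).continuous.comp
      ((paramMap hf hΨ h1.DL_pos).continuous.comp (by fun_prop))
  have hXm : Measurable fun ω => ((x 0 ω, D 0 ω), y 0 ω) := by fun_prop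
  have hXm' : Measurable fun ω => (x 0 ω, D 0 ω) := by fun_prop
  have hmap := hmodel.map_eq_compProd 0 hy hx hD
  have hgint : Integrable g ((P.map fun ω => (x 0 ω, D 0 ω)) ⊗ₘ marginalKernel ψstar) := by
    rw [← hmap, integrable_map_measure hg.aestronglyMeasurable hXm.aemeasurable]
    exact hFψ
  have hint : Integrable (fun s => ∫ t, g (s, t) ∂(marginalKernel ψstar s))
      (P.map fun ω => (x 0 ω, D 0 ω)) := 
    Integrable.integral_compProd (a := ()) (κ := Kernel.const Unit (P.map fun ω => (x 0 ω, D 0 ω)))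
      (η := Kernel.prodMkLeft Unit (marginalKernel ψstar)) hgint
  have hcongr : (fun ω => ∫ t, g ((x 0 ω, D 0 ω), t) ∂(marginalKernel ψstar (x 0 ω, D 0 ω)))
      =ᵐ[P] fun ω => ∫ t, f (D 0 ω, linPred (x 0 ω) ψ.1.1, ψ.1.2 + D 0 ω) t
        ∂(gaussianReal (linPred (x 0 ω) ψstar.1) (ψstar.2 + D 0 ω).toNNReal) := by
    filter_upwards [h1.D_mem 0] with ω hDω
    have hD0 : 0 ≤ D 0 ω := h1.DL_pos.le.trans hDω.1
    rw [Real.toNNReal_add hstar.le hD0, ← arg_of_le hDω.1]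
    rfl
  constructor
  · refine Integrable.congr ?_ hcongr
    exact (integrable_map_measure hint.aestronglyMeasurable hXm'.aemeasurable).1 hint
  · rw [← integral_congr_ae hcongr, ← integral_map hXm'.aemeasurable hint.aestronglyMeasurable,
      ← Measure.integral_compProd hgint, ← hmap,
      integral_map hXm.aemeasurable hg.aestronglyMeasurable]

/-- The design identifies the regression coefficient. -/
lemma eq_of_ae_linPred_eq (h1 : SamplingCondition P y x D DL DU) (h2 : CovariateCondition P x)
    {β β' : Vec p} (h : ∀ᵐ ω ∂P, linPred (x 0 ω) β = linPred (x 0 ω) β') : β = β' := by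
  by_contra hne
  obtain ⟨𝒳, h𝒳, hx𝒳⟩ := h2.bounded
  have hx := h1.measurable_x 0
  have hint : ∀ j k : Fin p, Integrable (fun ω => x 0 ω j * x 0 ω k) P := fun j k => by
    have hc : Continuous fun x : Vec p => x j * x k := by fun_prop
    obtain ⟨B, hB⟩ := h𝒳.isCompact_closure.exists_bound_of_continuousOn hc.continuousOn
    refine Integrable.mono' (integrable_const B)
      (hc.measurable.comp hx).aestronglyMeasurable ?_
    filter_upwards [hx𝒳 0] with ω hω
    exact hB _ (subset_closure hω)
  have hv : (fun j => β j - β' j) ≠ 0 := fun h0 => hne <| by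
    ext j
    exact sub_eq_zero.1 (congrFun h0 j)
  have hpos := (Matrix.posDef_iff_dotProduct_mulVec.1 (h2.posDef 0)).2 hv
  -- The quadratic form of $E[xx^\top]$ at $\beta-\beta'$ is $E[(x^\top(\beta-\beta'))^2]$, which
  -- vanishes by assumption.
  have hquad : star (fun j => β j - β' j) ⬝ᵥ
      ((Matrix.of fun j k : Fin p => ∫ ω, x 0 ω j * x 0 ω k ∂P).mulVec fun j => β j - β' j)
      = ∫ ω, (linPred (x 0 ω) β - linPred (x 0 ω) β') ^ 2 ∂P := by
    have hexp : ∀ ω, (linPred (x 0 ω) β - linPred (x 0 ω) β') ^ 2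
        = ∑ j, ∑ k, (β j - β' j) * (β k - β' k) * (x 0 ω j * x 0 ω k) := fun ω => by
      rw [linPred, linPred, ← Finset.sum_sub_distrib, sq, Finset.sum_mul_sum]
      refine Finset.sum_congr rfl fun j _ => Finset.sum_congr rfl fun k _ => ?_
      ring
    simp_rw [hexp]
    rw [integral_finsetSum _ fun j _ => integrable_finsetSum _ fun k _ => (hint j k).const_mul _]
    simp only [dotProduct, Matrix.mulVec, Matrix.of_apply, Pi.star_apply, star_trivial]
    refine Finset.sum_congr rfl fun j _ => ?_
    rw [integral_finsetSum _ fun k _ => (hint j k).const_mul _, Finset.mul_sum]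
    refine Finset.sum_congr rfl fun k _ => ?_
    rw [integral_const_mul]
    ring
  rw [hquad, integral_eq_zero_of_ae] at hpos
  · exact lt_irrefl _ hpos
  · filter_upwards [h] with ω hω
    simp [hω]

end Model

/-! ### Growth of likelihoods and posterior variances -/

lemma continuousOn_weight (κ γ : ℝ) : ContinuousOn (weight κ γ) (Set.Ioi 0) := by
  unfold weight
  refine continuousOn_const.mul (ContinuousOn.rpow_const (by fun_prop) fun v hv => Or.inl ?_)
  have := Real.pi_pos
  have : (0 : ℝ) < v := hv
  positivity

lemma quadraticGrowth_logLik : QuadraticGrowth fun q y => logLik q.2.1 q.2.2 y where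
  cont := by
    have hπ := Real.pi_pos
    unfold logLik
    refine ContinuousOn.sub (continuousOn_const.mul (ContinuousOn.log (by fun_prop) ?_))
      (ContinuousOn.div (by fun_prop) (by fun_prop) ?_)
    all_goals
      intro z hz
      have : 0 < z.1.2.2 := hz
      positivity
  bound := by
    have hπ := Real.pi_pos
    refine ⟨fun q => |Real.log (2 * Real.pi * q.2.2)| + (1 + q.2.1 ^ 2) / q.2.2, ?_, ?_⟩
    · refine ContinuousOn.add (ContinuousOn.abs (ContinuousOn.log (by fun_prop) ?_))
        (ContinuousOn.div (by fun_prop) (by fun_prop) ?_)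
      all_goals
        intro q hq
        have : 0 < q.2.2 := hq
        positivity
    · intro q y hq
      have h1 : |logLik q.2.1 q.2.2 y| ≤ |Real.log (2 * Real.pi * q.2.2)| / 2
          + (y - q.2.1) ^ 2 / (2 * q.2.2) := by
        unfold logLik
        refine (abs_sub _ _).trans (add_le_add (le_of_eq ?_) (le_of_eq ?_))
        · rw [abs_mul]
          norm_num
          ring
        · exact abs_of_nonneg (by positivity)
      have h2 : (y - q.2.1) ^ 2 / (2 * q.2.2) ≤ (1 + q.2.1 ^ 2) / q.2.2 * (1 + y ^ 2) := by
        rw [div_mul_eq_mul_div, div_le_div_iff₀ (by positivity) hq]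
        have : (y - q.2.1) ^ 2 ≤ 2 * ((1 + q.2.1 ^ 2) * (1 + y ^ 2)) := by
          nlinarith [sq_nonneg (y + q.2.1), sq_nonneg (y * q.2.1)]
        nlinarith
      have h3 : |Real.log (2 * Real.pi * q.2.2)| / 2
          ≤ |Real.log (2 * Real.pi * q.2.2)| * (1 + y ^ 2) := by
        have := abs_nonneg (Real.log (2 * Real.pi * q.2.2))
        nlinarith [sq_nonneg y]
      calc _ ≤ _ := h1
        _ ≤ _ := add_le_add h3 h2
        _ = _ := by ring

lemma continuousOn_exp_neg_sq (γ : ℝ) :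
    ContinuousOn (fun z : (ℝ × ℝ × ℝ) × ℝ => Real.exp (-γ * (z.2 - z.1.2.1) ^ 2 / (2 * z.1.2.2)))
      {z | 0 < z.1.2.2} := by
  refine (ContinuousOn.div (by fun_prop) (by fun_prop) fun z hz => ?_).rexp
  have : 0 < z.1.2.2 := hz
  positivity

lemma continuousOn_weight_comp (κ γ : ℝ) :
    ContinuousOn (fun q : ℝ × ℝ × ℝ => weight κ γ q.2.2) {q | 0 < q.2.2} :=
  (continuousOn_weight κ γ).comp (by fun_prop) fun _ hq => hq

lemma continuousOn_weight_comp_fst (κ γ : ℝ) :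
    ContinuousOn (fun z : (ℝ × ℝ × ℝ) × ℝ => weight κ γ z.1.2.2) {z | 0 < z.1.2.2} :=
  (continuousOn_weight κ γ).comp (by fun_prop) fun _ hq => hq

lemma exp_neg_sq_le_one {γ v : ℝ} (hγ : 0 < γ) (hv : 0 < v) (r : ℝ) :
    Real.exp (-γ * r ^ 2 / (2 * v)) ≤ 1 := by
  rw [Real.exp_le_one_iff]
  have : 0 ≤ γ * r ^ 2 / (2 * v) := by positivity
  have : -γ * r ^ 2 / (2 * v) = -(γ * r ^ 2 / (2 * v)) := by ring
  linarith

lemma quadraticGrowth_powLik {κ γ : ℝ} (hκ : 0 < κ) (hγ : 0 < γ) :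
    QuadraticGrowth fun q y => powLik κ γ q.2.1 q.2.2 y where
  cont := by
    unfold powLik
    exact ((continuousOn_weight_comp_fst κ γ).div_const γ).mul (continuousOn_exp_neg_sq γ)
  bound := by
    refine ⟨fun q => weight κ γ q.2.2 / γ, (continuousOn_weight_comp κ γ).div_const γ, ?_⟩
    intro q y hq
    have hw := weight_pos (γ := γ) hκ hq
    have he := exp_neg_sq_le_one hγ hq (y - q.2.1)
    unfold powLik
    rw [abs_of_nonneg (by positivity)]
    exact mul_le_mul_of_nonneg_left (he.trans (by nlinarith [sq_nonneg y])) (by positivity)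

lemma quadraticGrowth_bayesVar :
    QuadraticGrowth fun q _ => q.1 + q.1 ^ 2 * (-1 / q.2.2) where
  cont := by
    refine ContinuousOn.add (by fun_prop) (ContinuousOn.mul (by fun_prop)
      (ContinuousOn.div (by fun_prop) (by fun_prop) fun z hz => (ne_of_gt hz)))
  bound := by
    refine ⟨fun q => |q.1 + q.1 ^ 2 * (-1 / q.2.2)|, ?_, fun q y _ => ?_⟩
    · exact (ContinuousOn.add (by fun_prop) (ContinuousOn.mul (by fun_prop)
        (ContinuousOn.div (by fun_prop) (by fun_prop) fun z hz => (ne_of_gt hz)))).abs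
    · exact le_mul_of_one_le_right (abs_nonneg _) (by nlinarith [sq_nonneg y])

/-- In terms of $u=\gamma(y-\mu)^2/(2v)$ the curvature is $w(2u-1)e^{-u}/v$. Both $ue^{-u}$ and
$e^{-u}$ are at most $1$, whence $3=2+1$. -/
lemma abs_powLikDeriv2_le {κ γ μ v : ℝ} (hκ : 0 < κ) (hγ : 0 < γ) (hv : 0 < v) (y : ℝ) :
    |powLikDeriv2 κ γ μ v y| ≤ weight κ γ v * (3 / v) := by
  have hw := weight_pos (γ := γ) hκ hv
  set u := γ * (y - μ) ^ 2 / (2 * v) with hu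
  have hu0 : 0 ≤ u := by positivity
  have he : -γ * (y - μ) ^ 2 / (2 * v) = -u := by rw [hu]; ring
  have h1 : γ * (y - μ) ^ 2 / v ^ 2 - 1 / v = (2 * u - 1) / v := by
    rw [hu]; field_simp
  have hue : u * Real.exp (-u) ≤ 1 := by
    have := Real.add_one_le_exp u
    rw [Real.exp_neg, ← div_eq_mul_inv, div_le_one (Real.exp_pos _)]
    linarith
  have hle : Real.exp (-u) ≤ 1 := by rw [Real.exp_le_one_iff]; linarith
  have hpos := Real.exp_pos (-u)
  rw [powLikDeriv2, he, h1, mul_assoc, abs_mul, abs_of_pos hw]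
  refine mul_le_mul_of_nonneg_left ?_ hw.le
  rw [div_mul_eq_mul_div, abs_div, abs_of_pos hv]
  refine div_le_div_of_nonneg_right (abs_le.2 ⟨?_, ?_⟩) hv.le <;> nlinarith

lemma quadraticGrowth_powVar {κ γ : ℝ} (hκ : 0 < κ) (hγ : 0 < γ) :
    QuadraticGrowth fun q y => q.1 + q.1 ^ 2 * powLikDeriv2 κ γ q.2.1 q.2.2 y where
  cont := by
    unfold powLikDeriv2
    refine ContinuousOn.add (by fun_prop) (ContinuousOn.mul (by fun_prop)
      (((continuousOn_weight_comp_fst κ γ).mul ?_).mul (continuousOn_exp_neg_sq γ)))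
    refine ContinuousOn.sub (ContinuousOn.div (by fun_prop) (by fun_prop) fun z hz => ?_)
      (ContinuousOn.div (by fun_prop) (by fun_prop) fun z hz => (ne_of_gt hz))
    have : 0 < z.1.2.2 := hz
    positivity
  bound := by
    refine ⟨fun q => |q.1| + q.1 ^ 2 * (weight κ γ q.2.2 * (3 / q.2.2)), ?_, fun q y hq => ?_⟩
    · exact ContinuousOn.add (by fun_prop) (ContinuousOn.mul (by fun_prop)
        ((continuousOn_weight_comp κ γ).mul
          (ContinuousOn.div (by fun_prop) (by fun_prop) fun z hz => (ne_of_gt hz))))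
    · have hw := weight_pos (γ := γ) hκ hq
      refine ((abs_add_le _ _).trans (add_le_add le_rfl ?_)).trans
        (le_mul_of_one_le_right (by positivity) (by nlinarith [sq_nonneg y]))
      rw [abs_mul, abs_of_nonneg (sq_nonneg q.1)]
      exact mul_le_mul_of_nonneg_left (abs_powLikDeriv2_le hκ hγ hq y) (sq_nonneg _)

/-! ### Asymptotics of the estimated posterior variance -/

section Model

variable {Ω : Type*} [MeasurableSpace Ω] {P : Measure Ω} [IsProbabilityMeasure P]
  {p : ℕ} {θ y : ℕ → Ω → ℝ} {x : ℕ → Ω → Vec p} {D : ℕ → Ω → ℝ}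
  {ψstar : Vec p × ℝ} {Ψ : Set (Vec p × ℝ)} {DL DU : ℝ}

/-- The expected score of a strictly proper likelihood identifies the true parameter. -/
lemma integral_paramMap_lt (hmodel : CorrectlySpecified P θ y x D ψstar)
    (h1 : SamplingCondition P y x D DL DU) (h2 : CovariateCondition P x)
    (h3 : ParameterCondition Ψ ψstar DL) [CompactSpace Ψ] {L : ℝ → ℝ → ℝ → ℝ}
    (hL : StrictlyProper L) (hgL : QuadraticGrowth fun q y => L q.2.1 q.2.2 y) (ψ : Ψ)
    (hne : ψ ≠ ⟨ψstar, h3.true_mem⟩) :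
    (∫ ω, paramMap hgL h3.pos h1.DL_pos (y 0 ω, x 0 ω, D 0 ω) ∂P) ψ
      < (∫ ω, paramMap hgL h3.pos h1.DL_pos (y 0 ω, x 0 ω, D 0 ω) ∂P) ⟨ψstar, h3.true_mem⟩ := by
  have hstar := h3.pos _ h3.true_mem
  obtain ⟨hi, he⟩ := integral_paramMap_apply hmodel h1 h2 hgL h3.pos hstar ψ
  obtain ⟨hi', he'⟩ :=
    integral_paramMap_apply hmodel h1 h2 hgL h3.pos hstar ⟨ψstar, h3.true_mem⟩
  rw [he, he']
  have hlt : ∀ᵐ ω ∂P, (linPred (x 0 ω) ψ.1.1, ψ.1.2 + D 0 ω)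
        ≠ (linPred (x 0 ω) ψstar.1, ψstar.2 + D 0 ω) →
      ∫ t, L (linPred (x 0 ω) ψ.1.1) (ψ.1.2 + D 0 ω) t
        ∂(gaussianReal (linPred (x 0 ω) ψstar.1) (ψstar.2 + D 0 ω).toNNReal)
      < ∫ t, L (linPred (x 0 ω) ψstar.1) (ψstar.2 + D 0 ω) t
        ∂(gaussianReal (linPred (x 0 ω) ψstar.1) (ψstar.2 + D 0 ω).toNNReal) := by
    filter_upwards [h1.D_mem 0] with ω hDω hq
    have hD0 : 0 < D 0 ω := h1.DL_pos.trans_le hDω.1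
    exact hL _ _ _ _ (add_pos (h3.pos _ ψ.2) hD0) (add_pos hstar hD0) hq
  have hle : (fun ω => ∫ t, L (linPred (x 0 ω) ψ.1.1) (ψ.1.2 + D 0 ω) t
        ∂(gaussianReal (linPred (x 0 ω) ψstar.1) (ψstar.2 + D 0 ω).toNNReal))
      ≤ᵐ[P] fun ω => ∫ t, L (linPred (x 0 ω) ψstar.1) (ψstar.2 + D 0 ω) t
        ∂(gaussianReal (linPred (x 0 ω) ψstar.1) (ψstar.2 + D 0 ω).toNNReal) := by
    filter_upwards [hlt] with ω hω
    by_cases hq : (linPred (x 0 ω) ψ.1.1, ψ.1.2 + D 0 ω)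
        = (linPred (x 0 ω) ψstar.1, ψstar.2 + D 0 ω)
    · obtain ⟨hq1, hq2⟩ := Prod.mk.inj hq
      rw [hq1, hq2]
    · exact (hω hq).le
  -- Equal expectations would force almost sure equality of the conditional scores, hence of means
  -- and variances; the design then identifies $\beta$, and cancelling $D$ at one sample point
  -- identifies $A$.
  refine lt_of_le_of_ne (integral_mono_ae hi hi' hle) fun heq => hne ?_
  have hae := (integral_eq_iff_of_ae_le hi hi' hle).1 heq
  have hq : ∀ᵐ ω ∂P, (linPred (x 0 ω) ψ.1.1, ψ.1.2 + D 0 ω)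
      = (linPred (x 0 ω) ψstar.1, ψstar.2 + D 0 ω) := by
    filter_upwards [hlt, hae] with ω hω hωeq
    by_contra hc
    exact (hω hc).ne hωeq
  obtain ⟨ω, hω⟩ := hq.exists
  refine Subtype.ext (Prod.ext ?_ (add_right_cancel (Prod.ext_iff.1 hω).2))
  exact eq_of_ae_linPred_eq h1 h2 (hq.mono fun ω hω => (Prod.ext_iff.1 hω).1)

lemma ae_tendsto_average_paramMap (hmodel : CorrectlySpecified P θ y x D ψstar)
    (h1 : SamplingCondition P y x D DL DU) (h2 : CovariateCondition P x)
    (h3 : ParameterCondition Ψ ψstar DL) [CompactSpace Ψ] {f : ℝ × ℝ × ℝ → ℝ → ℝ}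
    (hf : QuadraticGrowth f) :
    ∀ᵐ ω ∂P, Tendsto (fun n : ℕ => (n : ℝ)⁻¹ • ∑ i ∈ Finset.range n,
      paramMap hf h3.pos h1.DL_pos (y i ω, x i ω, D i ω)) atTop
      (𝓝 (∫ ω, paramMap hf h3.pos h1.DL_pos (y 0 ω, x 0 ω, D 0 ω) ∂P)) :=
  ae_tendsto_average_continuousMap (X := fun i ω => (y i ω, x i ω, D i ω)) h1.indep h1.ident
    (paramMap hf h3.pos h1.DL_pos) (integrable_paramMap hmodel h1 h2 hf h3.pos)

/-- The average estimated posterior variance converges almost surely to the expected posterior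
variance at the true parameter. -/
lemma ae_tendsto_average_totalVar (hmodel : CorrectlySpecified P θ y x D ψstar)
    (h1 : SamplingCondition P y x D DL DU) (h2 : CovariateCondition P x)
    (h3 : ParameterCondition Ψ ψstar DL) {c : ℝ → ℝ → ℝ → ℝ} {γ : ℝ}
    {L H : ℝ → ℝ → ℝ → ℝ} (hcL : ∀ μ v, 0 < v → gammaLik c γ μ v = L μ v)
    (hLH : ∀ μ v, 0 < v → iteratedDeriv 2 (L μ v) = H μ v)
    (hL : StrictlyProper L) (hgL : QuadraticGrowth fun q y => L q.2.1 q.2.2 y)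
    (hgH : QuadraticGrowth fun q y => q.1 + q.1 ^ 2 * H q.2.1 q.2.2 y)
    {ψhat : ℕ → Ω → Vec p × ℝ}
    (hψ : ∀ m, ∀ᵐ ω ∂P, ψhat m ω ∈ Ψ ∧ IsMaxOn (objective c y x D m γ ω) Ψ (ψhat m ω)) :
    ∀ᵐ ω ∂P, Tendsto (fun m : ℕ => (m : ℝ)⁻¹ * totalVar c y x D m γ ω (ψhat m ω)) atTop
      (𝓝 (∫ ω, ∫ t, (D 0 ω + D 0 ω ^ 2 * H (linPred (x 0 ω) ψstar.1) (ψstar.2 + D 0 ω) t)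
        ∂(gaussianReal (linPred (x 0 ω) ψstar.1) (ψstar.2 + D 0 ω).toNNReal) ∂P)) := by
  have : CompactSpace Ψ := isCompact_iff_compactSpace.1 h3.compact
  have hlim := (integral_paramMap_apply hmodel h1 h2 hgH h3.pos (h3.pos _ h3.true_mem)
    ⟨ψstar, h3.true_mem⟩).2
  simp only at hlim
  rw [← hlim]
  filter_upwards [ae_tendsto_average_paramMap hmodel h1 h2 h3 hgL,
    ae_tendsto_average_paramMap hmodel h1 h2 h3 hgH, ae_all_iff.2 hψ,
    ae_all_iff.2 h1.D_mem] with ω hG hH hmax hDω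
  have hGeq : ∀ (m : ℕ) (ψ : Ψ), ((m : ℝ)⁻¹ • ∑ i ∈ Finset.range m,
      paramMap hgL h3.pos h1.DL_pos (y i ω, x i ω, D i ω)) ψ
      = (m : ℝ)⁻¹ * objective c y x D m γ ω ψ := by
    intro m ψ
    rw [ContinuousMap.smul_apply, ContinuousMap.sum_apply, smul_eq_mul, objective]
    congr 1
    refine Finset.sum_congr rfl fun i _ => ?_
    rw [paramMap_apply, arg_of_le (hDω i).1,
      hcL _ _ (add_pos (h3.pos _ ψ.2) (h1.DL_pos.trans_le (hDω i).1))]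
  have hHeq : ∀ (m : ℕ) (ψ : Ψ), ((m : ℝ)⁻¹ • ∑ i ∈ Finset.range m,
      paramMap hgH h3.pos h1.DL_pos (y i ω, x i ω, D i ω)) ψ
      = (m : ℝ)⁻¹ * totalVar c y x D m γ ω ψ := by
    intro m ψ
    rw [ContinuousMap.smul_apply, ContinuousMap.sum_apply, smul_eq_mul, totalVar]
    congr 1
    refine Finset.sum_congr rfl fun i _ => ?_
    have hv : 0 < ψ.1.2 + D i ω := add_pos (h3.pos _ ψ.2) (h1.DL_pos.trans_le (hDω i).1)
    rw [paramMap_apply, arg_of_le (hDω i).1, robustVar, hcL _ _ hv, hLH _ _ hv]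
  have key := tendsto_eval_argmax hG hH
    (integral_paramMap_lt hmodel h1 h2 h3 hL hgL) (u := fun m => ⟨ψhat m ω, (hmax m).1⟩)
    (fun m b => by
      rw [hGeq, hGeq]
      exact mul_le_mul_of_nonneg_left ((hmax m).2 b.2) (by positivity))
  refine key.congr fun m => ?_
  rw [hHeq]

/-- For `γ > 0` the expected posterior variance at the true parameter exceeds that of `γ = 0`. -/
lemma integral_bayesVar_lt_integral_powVar (hmodel : CorrectlySpecified P θ y x D ψstar)
    (h1 : SamplingCondition P y x D DL DU) (h2 : CovariateCondition P x)
    (h3 : ParameterCondition Ψ ψstar DL) {κ γ : ℝ} (hγ : 0 < γ) (hκ : 0 < κ)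
    (hκ' : κ ≤ (1 + γ) ^ (γ / (2 * (1 + γ)))) :
    ∫ ω, ∫ _, (D 0 ω + D 0 ω ^ 2 * (-1 / (ψstar.2 + D 0 ω)))
        ∂(gaussianReal (linPred (x 0 ω) ψstar.1) (ψstar.2 + D 0 ω).toNNReal) ∂P
      < ∫ ω, ∫ t, (D 0 ω + D 0 ω ^ 2 *
          powLikDeriv2 κ γ (linPred (x 0 ω) ψstar.1) (ψstar.2 + D 0 ω) t)
        ∂(gaussianReal (linPred (x 0 ω) ψstar.1) (ψstar.2 + D 0 ω).toNNReal) ∂P := by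
  have : CompactSpace Ψ := isCompact_iff_compactSpace.1 h3.compact
  have hstar := h3.pos _ h3.true_mem
  have hi := (integral_paramMap_apply hmodel h1 h2 quadraticGrowth_bayesVar h3.pos hstar
    ⟨ψstar, h3.true_mem⟩).1
  have hi' := (integral_paramMap_apply hmodel h1 h2 (quadraticGrowth_powVar hκ hγ) h3.pos hstar
    ⟨ψstar, h3.true_mem⟩).1
  have hlt : ∀ᵐ ω ∂P, ∫ _, (D 0 ω + D 0 ω ^ 2 * (-1 / (ψstar.2 + D 0 ω)))
        ∂(gaussianReal (linPred (x 0 ω) ψstar.1) (ψstar.2 + D 0 ω).toNNReal)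
      < ∫ t, (D 0 ω + D 0 ω ^ 2 *
          powLikDeriv2 κ γ (linPred (x 0 ω) ψstar.1) (ψstar.2 + D 0 ω) t)
        ∂(gaussianReal (linPred (x 0 ω) ψstar.1) (ψstar.2 + D 0 ω).toNNReal) := by
    filter_upwards [h1.D_mem 0] with ω hDω
    have hD0 : 0 < D 0 ω := h1.DL_pos.trans_le hDω.1
    have hv : 0 < ψstar.2 + D 0 ω := add_pos hstar hD0
    have hw := weight_lt hγ hκ hκ' hv (by linarith [h3.lower, hDω.1])
    have hs : 0 < √(1 + γ) := Real.sqrt_pos.2 (by positivity)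
    have hint : Integrable
        (fun t => powLikDeriv2 κ γ (linPred (x 0 ω) ψstar.1) (ψstar.2 + D 0 ω) t)
        (gaussianReal (linPred (x 0 ω) ψstar.1) (ψstar.2 + D 0 ω).toNNReal) := by
      refine Integrable.mono' (integrable_const _) ?_
        (Eventually.of_forall fun t => abs_powLikDeriv2_le hκ hγ hv t)
      unfold powLikDeriv2
      exact Continuous.aestronglyMeasurable (by fun_prop)
    rw [integral_add (integrable_const _) (hint.const_mul _), integral_const_mul,
      integral_powLikDeriv2 hγ hv]
    simp only [integral_const, probReal_univ, smul_eq_mul, one_mul]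
    have hratio : weight κ γ (ψstar.2 + D 0 ω) / ((1 + γ) * √(1 + γ)) < 1 :=
      (div_lt_one (by positivity)).2 hw
    have : -1 / (ψstar.2 + D 0 ω)
        < -(weight κ γ (ψstar.2 + D 0 ω) / ((1 + γ) * √(1 + γ))) / (ψstar.2 + D 0 ω) :=
      div_lt_div_of_pos_right (by linarith) hv
    have := mul_lt_mul_of_pos_left this (by positivity : 0 < D 0 ω ^ 2)
    linarith
  have hle := hlt.mono fun ω hω => hω.le
  refine lt_of_le_of_ne (integral_mono_ae hi hi' hle) fun heq => ?_
  obtain ⟨ω, hω, hω'⟩ := (hlt.and ((integral_eq_iff_of_ae_le hi hi' hle).1 heq)).exists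
  exact hω.ne hω'

end Model

/-! ### The case $\gamma=0$ and the conclusion -/

lemma robustMean_zero {p : ℕ} (c : ℝ → ℝ → ℝ → ℝ) {ψ : Vec p × ℝ} {D : ℝ} (hv : 0 < ψ.2 + D)
    (y : ℝ) (x : Vec p) : robustMean c 0 ψ y x D = bayesMean ψ y x D := by
  rw [robustMean, gammaLik_zero c hv, deriv_logLik hv, bayesMean]
  ring

lemma robustVar_zero {p : ℕ} (c : ℝ → ℝ → ℝ → ℝ) {ψ : Vec p × ℝ} {D : ℝ} (hv : 0 < ψ.2 + D)
    (y : ℝ) (x : Vec p) : robustVar c 0 ψ y x D = bayesVar ψ.2 D := by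
  rw [robustVar, gammaLik_zero c hv, iteratedDeriv_two_logLik hv, bayesVar]
  field_simp
  ring

end FayHerriot

theorem theorem1 {Ω : Type*} [MeasurableSpace Ω] (P : Measure Ω) [IsProbabilityMeasure P]
    {p : ℕ} (θ y : ℕ → Ω → ℝ) (x : ℕ → Ω → FayHerriot.Vec p) (D : ℕ → Ω → ℝ)
    (ψstar : FayHerriot.Vec p × ℝ) (Ψ : Set (FayHerriot.Vec p × ℝ)) (DL DU : ℝ)
    (hmodel : FayHerriot.CorrectlySpecified P θ y x D ψstar)
    (h1 : FayHerriot.SamplingCondition P y x D DL DU)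
    (h2 : FayHerriot.CovariateCondition P x)
    (h3 : FayHerriot.ParameterCondition Ψ ψstar DL)
    (Γ : Finset ℝ) (hΓ : FayHerriot.IsGrid Γ)
    (c : ℝ → ℝ → ℝ → ℝ)
    (hc : c = FayHerriot.integralNormaliser ∨ c = FayHerriot.closedNormaliser)
    (ψhat : ℕ → ℝ → Ω → FayHerriot.Vec p × ℝ)
    (hψhat : FayHerriot.IsRobustEstimator P c y x D Ψ Γ ψhat)
    (γop : ℕ → Ω → ℝ) (hγop : FayHerriot.IsSelected P c y x D Γ ψhat γop) :
    Tendsto (fun m => P {ω | γop m ω = 0}) atTop (𝓝 1) ∧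
    Tendsto (fun m => P {ω | ∀ i < m,
      FayHerriot.robustMean c (γop m ω) (ψhat m (γop m ω) ω) (y i ω) (x i ω) (D i ω)
        = FayHerriot.bayesMean (ψhat m 0 ω) (y i ω) (x i ω) (D i ω) ∧
      FayHerriot.robustVar c (γop m ω) (ψhat m (γop m ω) ω) (y i ω) (x i ω) (D i ω)
        = FayHerriot.bayesVar (ψhat m 0 ω).2 (D i ω)}) atTop (𝓝 1) := by
  have hzero := FayHerriot.ae_tendsto_average_totalVar hmodel h1 h2 h3
    (fun μ v hv => FayHerriot.gammaLik_zero c hv)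
    (fun μ v hv => FayHerriot.iteratedDeriv_two_logLik hv)
    FayHerriot.strictlyProper_logLik FayHerriot.quadraticGrowth_logLik
    FayHerriot.quadraticGrowth_bayesVar (fun m => hψhat m 0 hΓ.zero_mem)
  have hpos : ∀ γ ∈ Γ, γ ≠ 0 → ∀ᵐ ω ∂P, ∀ᶠ m : ℕ in atTop,
      FayHerriot.totalVar c y x D m 0 ω (ψhat m 0 ω)
        < FayHerriot.totalVar c y x D m γ ω (ψhat m γ ω) := by
    intro γ hγΓ hγ0
    have hγ : 0 < γ := lt_of_le_of_ne (hΓ.subset γ hγΓ).1 hγ0.symm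
    obtain ⟨κ, hκ, hκ', hlik⟩ := FayHerriot.exists_gammaLik_eq_powLik hc hγ
    have hlim := FayHerriot.ae_tendsto_average_totalVar hmodel h1 h2 h3 hlik
      (fun μ v hv => FayHerriot.iteratedDeriv_two_powLik hγ hv)
      (FayHerriot.strictlyProper_powLik hκ hγ) (FayHerriot.quadraticGrowth_powLik hκ hγ)
      (FayHerriot.quadraticGrowth_powVar hκ hγ) (fun m => hψhat m γ hγΓ)
    have hlt := FayHerriot.integral_bayesVar_lt_integral_powVar hmodel h1 h2 h3 hγ hκ hκ'
    filter_upwards [hzero, hlim] with ω h0 hγlim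
    filter_upwards [h0.eventually_lt hγlim hlt] with m hm
    -- Only $m^{-1}\ge0$ is needed, so $m=0$, where $m^{-1}=0$, is no exception.
    exact lt_of_mul_lt_mul_left hm (by positivity)
  have hsel : ∀ᵐ ω ∂P, ∀ᶠ m in atTop, γop m ω = 0 := by
    have hall : ∀ᵐ ω ∂P, ∀ γ ∈ Γ, γ ≠ 0 → ∀ᶠ m : ℕ in atTop,
        FayHerriot.totalVar c y x D m 0 ω (ψhat m 0 ω)
          < FayHerriot.totalVar c y x D m γ ω (ψhat m γ ω) := by
      refine (ae_ball_iff Γ.countable_toSet).2 fun γ hγ => ?_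
      by_cases h0 : γ = 0
      · exact Eventually.of_forall fun ω h => absurd h0 h
      · filter_upwards [hpos γ hγ h0] with ω hω _ using hω
    filter_upwards [hall, ae_all_iff.2 hγop] with ω hω hop
    have hev : ∀ᶠ m : ℕ in atTop, ∀ γ ∈ Γ, γ ≠ 0 →
        FayHerriot.totalVar c y x D m 0 ω (ψhat m 0 ω)
          < FayHerriot.totalVar c y x D m γ ω (ψhat m γ ω) := by
      refine (eventually_all_finset Γ).2 fun γ hγ => ?_
      by_cases h0 : γ = 0
      · exact Eventually.of_forall fun m h => absurd h0 h
      · exact (hω γ hγ h0).mono fun m hm _ => hm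
    filter_upwards [hev] with m hm
    by_contra hne
    -- A nonzero selected value would have total variance strictly above that of the candidate $0$,
    -- contradicting minimality.
    exact absurd ((hop m).2 hΓ.zero_mem) (not_le.2 (hm _ (hop m).1 hne))
  refine ⟨FayHerriot.tendsto_measure_of_ae_eventually hsel,
    FayHerriot.tendsto_measure_of_ae_eventually ?_⟩
  filter_upwards [hsel, ae_all_iff.2 fun m => hψhat m 0 hΓ.zero_mem, ae_all_iff.2 h1.D_mem]
    with ω hω hψ hD
  filter_upwards [hω] with m hm i _
  have hv : 0 < (ψhat m 0 ω).2 + D i ω :=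
    add_pos (h3.pos _ (hψ m).1) (h1.DL_pos.trans_le (hD i).1)
  rw [hm]
  exact ⟨FayHerriot.robustMean_zero c hv _ _, FayHerriot.robustVar_zero c hv _ _⟩
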